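/- Consider the M/M/$c$/$K$ retrial queue ($K\ge c\ge 1$): primary customers arrive in a Poisson process of rate $\lambda>0$; the total service rate is $\nu_i$ when $i$ customers are in the system (servers and waiting room), with $0=\nu_0\le\nu_1\le\dots\le\nu_K$; a primary customer who finds $K$ customers in the system joins the orbit with probability $p\in[0,1]$ and is lost otherwise; each orbiting customer retries after an exponential time of rate $\mu>0$, enters the system if it holds fewer than $K$ customers, and otherwise returns to the orbit (this is the case $q=r=1$ of the model with abandonment, i.e. retrial customers never abandon). Let $X(t)=(C(t),N(t))$, where $C(t)$ is the number of customers in the system and $N(t)$ the number in the orbit. Then $X$ is a continuous-time Markov chain on $\{0,\dots,K\}\times\mathbb Z_+$ whose transition rates out of $(i,n)$ are: \[ \begin{aligned} &(i,n)\to(i+1,n): \ \lambda\ \ (i<K), &\quad &(i,n)\to(i-1,n):\ \nu_i\ \ (i\ge 1),\\ &(K,n)\to(K,n+1):\ \lambda p, &\quad &(i,n)\to(i+1,n-1):\ n\mu\ \ (i<K,\ n\ge1). \end{aligned} \] Assume that $X$ is ergodic, that is, irreducible with transition probabilities converging, from every initial state, to one probability distribution (in particular $p>0$ and $\nu_1>0$),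 and let \[ \pi_{i,n}=\lim_{t\to\infty}\Pr\{C(t)=i,\ N(t)=n\}. \] Put \[ \rho=\frac{\lambda p}{\nu_K},\qquad \alpha=\frac{\rho\,(\nu_K-p\,\nu_{K-1})}{p\,\mu}. \] Then for every $k=1,2,\dots,K$ there exist constants $D_1^{(k)}>0$ and $D_2^{(k)}>0$, independent of $n$, such that \[ D_1^{(k)}\,n^{\alpha-k}\rho^n\ \le\ \pi_{K-k,n}\ \le\ D_2^{(k)}\,n^{\alpha-k}\rho^n\qquad\text{for all } n\ge 1. \] -/

import Mathlib

open Filter Topology MeasureTheory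
open scoped NNReal

/-- Parameters of the Markovian multiserver retrial queue with system capacity `K` (servers and
waiting room), arrival rate `lam`, total service rate `nu i` when `i ≤ K` customers are in the
system, retrial rate `mu` per orbiting customer, probability `p` that a blocked primary customer
joins the orbit, probability `r` that a customer leaving the orbit retries, and probability `q`
that a blocked retrial customer rejoins the orbit. The values `nu i` for `i > K` are never used. -/
structure RetrialQueue where
  K : ℕ
  lam : ℝ
  mu : ℝ
  nu : ℕ → ℝ
  p : ℝ
  q : ℝ
  r : ℝ
  K_pos : 0 < K
  lam_pos : 0 < lam
  mu_pos : 0 < mu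
  nu_zero : nu 0 = 0
  nu_mono : ∀ i < K, nu i ≤ nu (i + 1)
  p_mem : p ∈ Set.Icc (0 : ℝ) 1
  q_mem : q ∈ Set.Icc (0 : ℝ) 1
  r_mem : r ∈ Set.Icc (0 : ℝ) 1

namespace RetrialQueue

variable (M : RetrialQueue)

/-- States `(i, n)`: `i` customers in the system, `n` customers in the orbit. -/
abbrev State : Type := Fin (M.K + 1) × ℕ

/-- The block of transitions that raise the orbit size by one. -/
noncomputable def Q0 : Matrix (Fin (M.K + 1)) (Fin (M.K + 1)) ℝ :=
  Matrix.of fun i j => if (i : ℕ) = M.K ∧ (j : ℕ) = M.K then M.lam * M.p else 0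

/-- The block of transitions that keep the orbit size `n`, with its diagonal. -/
noncomputable def Q1 (n : ℕ) : Matrix (Fin (M.K + 1)) (Fin (M.K + 1)) ℝ :=
  Matrix.of fun i j =>
    if (j : ℕ) = i + 1 then M.lam
    else if (i : ℕ) = j + 1 then M.nu i
    else if i = j then
      if (i : ℕ) = M.K then
        -(M.lam * M.p + n * M.mu * ((1 - M.r) + M.r * (1 - M.q)) + M.nu M.K)
      else -(M.lam + n * M.mu + M.nu i)
    else 0

/-- The block of transitions that lower the orbit size from `n` to `n - 1`. -/
noncomputable def Q2 (n : ℕ) : Matrix (Fin (M.K + 1)) (Fin (M.K + 1)) ℝ :=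
  Matrix.of fun i j =>
    if i = j then
      if (i : ℕ) = M.K then n * M.mu * ((1 - M.r) + M.r * (1 - M.q))
      else n * M.mu * (1 - M.r)
    else if (j : ℕ) = i + 1 then n * M.mu * M.r
    else 0

/-- The infinitesimal generator, block tridiagonal in the orbit size. -/
noncomputable def generator (x y : M.State) : ℝ :=
  if y.2 = x.2 + 1 then M.Q0 x.1 y.1
  else if y.2 = x.2 then M.Q1 x.2 x.1 y.1
  else if x.2 = y.2 + 1 then M.Q2 x.2 x.1 y.1
  else 0

/-- The traffic intensity `ρ = λ p / ν_K`. -/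
noncomputable def rho : ℝ := M.lam * M.p / M.nu M.K

/-- The exponent `α = ρ (ν_K - p ν_{K-1}) / (p μ)`. -/
noncomputable def alpha : ℝ :=
  M.rho * (M.nu M.K - M.p * M.nu (M.K - 1)) / (M.p * M.mu)

end RetrialQueue

/-- `P` is an honest standard transition function on the countable set `S` with
infinitesimal generator `Q`. -/
structure IsTransitionFunction {S : Type*} [DecidableEq S] (Q : S → S → ℝ)
    (P : ℝ≥0 → S → S → ℝ) : Prop where
  nonneg : ∀ t x y, 0 ≤ P t x y
  hasSum_one : ∀ t x, HasSum (P t x) 1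
  zero : ∀ x y, P 0 x y = if x = y then 1 else 0
  chapman_kolmogorov : ∀ s t x y, HasSum (fun z => P s x z * P t z y) (P (s + t) x y)
  deriv_zero : ∀ x y,
    Tendsto (fun t : ℝ≥0 => (P t x y - P 0 x y) / (t : ℝ)) (𝓝[>] 0) (𝓝 (Q x y))

/-- `X` is, under `ℙ`, a continuous-time Markov chain with transition function `P`
(and arbitrary initial law), expressed through its finite-dimensional distributions. -/
structure IsMarkovChain {S Ω : Type*} [MeasurableSpace S] [MeasurableSpace Ω]
    (P : ℝ≥0 → S → S → ℝ) (ℙ : Measure Ω) (X : ℝ≥0 → Ω → S) : Prop where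
  measurable : ∀ t, Measurable (X t)
  finite_dim : ∀ (m : ℕ) (t : Fin (m + 1) → ℝ≥0), Monotone t → ∀ x : Fin (m + 1) → S,
    ℙ.real {ω | ∀ i, X (t i) ω = x i} =
      ℙ.real {ω | X (t 0) ω = x 0} *
        ∏ i : Fin m, P (t i.succ - t i.castSucc) (x i.castSucc) (x i.succ)

/-- Ergodicity: the chain is irreducible, and its transition probabilities converge, for every
initial state, to one and the same probability distribution. -/
structure IsErgodic {S : Type*} (P : ℝ≥0 → S → S → ℝ) : Prop where
  irreducible : ∀ x y, ∃ t, 0 < P t x y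
  exists_limit : ∃ w : S → ℝ, HasSum w 1 ∧
    ∀ x y, Tendsto (fun t => P t x y) atTop (𝓝 (w y))

/-! ### Sequences with ratio `ρ (1 + α / n + O(n⁻²))` -/

/-! Write `L + 1` for the capacity and `a i n` for the limit probabilities. Two families of cut
equations determine the asymptotics: flow balance between orbit sizes `n` and `n + 1`, and flow
balance of the sets `{0, …, i} × {n}`.

At a fixed orbit size each level below the top costs a factor `1 / n`, because a state with a free
place is left at a rate of order `n * mu`. The upper half of this is `exists_sum_mul_pow_le` with
`exists_le_succ`, the lower half `exists_top_le`. Fed back into the cut equations, these estimates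
close up, to relative error `O(n⁻²)`, into a one-step recursion for the top level alone
(`exists_abs_recursion_le`). Its ratio is `ρ (1 + α / n + O(n⁻²))`, so the top level has exact order
`n ^ α * ρ ^ n` by `exists_bounds_of_ratio`, and the level `k` places lower is smaller by `n ^ k`.

On the probabilistic side, the limit law is only shown to be subinvariant for the generator.
`isRetrialSolution_of_balance` upgrades this to the exact cut equations by telescoping the slacks
and using that the flow across large orbit sizes tends to zero. -/

theorem abs_log_one_add_sub_le {x : ℝ} (hx : -(1 / 2) ≤ x) :
    |Real.log (1 + x) - x| ≤ 2 * x ^ 2 := by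
  have h1 : 0 < 1 + x := by linarith
  have hu := Real.log_le_sub_one_of_pos h1
  have hl := Real.one_sub_inv_le_log_of_pos h1
  have h2 : 1 - (1 + x)⁻¹ = x - x ^ 2 / (1 + x) := by field_simp; ring
  have h3 : x ^ 2 / (1 + x) ≤ 2 * x ^ 2 := by
    rw [div_le_iff₀ h1]
    nlinarith [sq_nonneg x]
  rw [abs_le]
  constructor <;> nlinarith [sq_nonneg x]

theorem isBigO_log_one_add_sub {x : ℕ → ℝ}
    (hx : x =O[atTop] fun n : ℕ => ((n : ℝ))⁻¹) :
    (fun n => Real.log (1 + x n) - x n) =O[atTop] fun n : ℕ => ((n : ℝ) ^ 2)⁻¹ := by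
  have hx0 : Tendsto x atTop (𝓝 0) := hx.trans_tendsto tendsto_inv_atTop_nhds_zero_nat
  have h1 : (fun n => Real.log (1 + x n) - x n) =O[atTop] fun n => x n ^ 2 := by
    refine Asymptotics.IsBigO.of_bound 2 ?_
    filter_upwards [hx0.eventually (lt_mem_nhds (show -(1 / 2 : ℝ) < 0 by norm_num))] with n hn
    simpa using abs_log_one_add_sub_le hn.le
  simpa [inv_pow] using h1.trans (hx.pow 2)

theorem isBigO_inv_add_sub_inv (k : ℕ) :
    (fun n : ℕ => ((n : ℝ) + k)⁻¹ - (n : ℝ)⁻¹) =O[atTop] fun n : ℕ => ((n : ℝ) ^ 2)⁻¹ := by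
  refine Asymptotics.IsBigO.of_bound k ?_
  filter_upwards [eventually_gt_atTop 0] with n hn
  have hn' : (0 : ℝ) < n := by exact_mod_cast hn
  have h : ((n : ℝ) + k)⁻¹ - (n : ℝ)⁻¹ = -(k / (n * (n + k))) := by field_simp; ring
  rw [h, norm_neg, Real.norm_of_nonneg (by positivity), Real.norm_of_nonneg (by positivity),
    ← div_eq_mul_inv]
  gcongr
  nlinarith [(Nat.cast_nonneg k : (0 : ℝ) ≤ k)]

theorem isBigO_inv_sq_inv :
    (fun n : ℕ => ((n : ℝ) ^ 2)⁻¹) =O[atTop] fun n : ℕ => ((n : ℝ))⁻¹ := by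
  refine Asymptotics.IsBigO.of_bound 1 ?_
  filter_upwards [eventually_gt_atTop 0] with n hn
  have hn' : (1 : ℝ) ≤ n := by exact_mod_cast hn
  rw [Real.norm_of_nonneg (by positivity), Real.norm_of_nonneg (by positivity), one_mul]
  gcongr
  nlinarith

theorem isBigO_inv_add (k : ℕ) :
    (fun n : ℕ => ((n : ℝ) + k)⁻¹) =O[atTop] fun n : ℕ => ((n : ℝ))⁻¹ := by
  simpa using ((isBigO_inv_add_sub_inv k).trans isBigO_inv_sq_inv).add
    (Asymptotics.isBigO_refl (fun n : ℕ => (n : ℝ)⁻¹) atTop)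

theorem isBigO_log_one_add_div (c : ℝ) (k : ℕ) :
    (fun n : ℕ => Real.log (1 + c / ((n : ℝ) + k)) - c / n) =O[atTop]
      fun n : ℕ => ((n : ℝ) ^ 2)⁻¹ := by
  have h1 := isBigO_log_one_add_sub ((isBigO_inv_add k).const_mul_left c)
  have h2 := (isBigO_inv_add_sub_inv k).const_mul_left c
  refine (h1.add h2).congr_left fun n => ?_
  simp only [div_eq_mul_inv]
  ring

/-- A positive sequence whose consecutive ratios are `ρ (1 + (γ - β) / n + O(n⁻²))` is of exact
order `n ^ (γ - β) * ρ ^ n`. -/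
theorem exists_bounds_of_ratio {h e : ℕ → ℝ} {ρ β γ C : ℝ} (hh : ∀ n, 0 < h n) (hρ : 0 < ρ)
    (hβ : 0 ≤ β) (he : ∀ n, |e n| ≤ C / ((n : ℝ) + 1) ^ 2)
    (hrec : ∀ n : ℕ, h (n + 1) * (1 + β / ((n : ℝ) + 2)) =
      ρ * h n * (1 + γ / ((n : ℝ) + 1) + e n)) :
    ∃ D₁ D₂ : ℝ, 0 < D₁ ∧ 0 < D₂ ∧ ∀ n : ℕ, 1 ≤ n →
      D₁ * (n : ℝ) ^ (γ - β) * ρ ^ n ≤ h n ∧ h n ≤ D₂ * (n : ℝ) ^ (γ - β) * ρ ^ n := by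
  have heO : e =O[atTop] fun n : ℕ => ((n : ℝ) ^ 2)⁻¹ := by
    refine Asymptotics.IsBigO.of_bound C ?_
    filter_upwards [eventually_gt_atTop 0] with n hn
    have hn' : (0 : ℝ) < n := by exact_mod_cast hn
    have hC : 0 ≤ C := by simpa using (abs_nonneg _).trans (he 0)
    rw [Real.norm_of_nonneg (by positivity : (0 : ℝ) ≤ ((n : ℝ) ^ 2)⁻¹), ← div_eq_mul_inv]
    refine (he n).trans ?_
    gcongr
    linarith
  set x : ℕ → ℝ := fun n => γ * ((n : ℝ) + (1 : ℕ))⁻¹ + e n with hx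
  have hxO : x =O[atTop] fun n : ℕ => ((n : ℝ))⁻¹ :=
    ((isBigO_inv_add 1).const_mul_left γ).add (heO.trans isBigO_inv_sq_inv)
  -- It suffices that `g`, the logarithm of `h n` over its conjectured order, is bounded. Its
  -- increments turn out to be summable, so it even converges. The value `Real.log 0 = 0` only
  -- affects `g 0`.
  set g : ℕ → ℝ := fun n => Real.log (h n) - n * Real.log ρ - (γ - β) * Real.log n with hg
  have hgO : (fun n => g (n + 1) - g n) =O[atTop] fun n : ℕ => ((n : ℝ) ^ 2)⁻¹ := by
    have h1 := isBigO_log_one_add_sub hxO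
    have h2 := ((isBigO_inv_add_sub_inv 1).const_mul_left γ).add heO
    have h3 := isBigO_log_one_add_div β 2
    have h4 := (isBigO_log_one_add_div 1 0).const_mul_left (γ - β)
    -- The terms in `1 / n` cancel: `γ` from `x`, `-β` from the left factor, `-(γ - β)` from the
    -- increment of `Real.log n`.
    refine (((h1.add h2).sub h3).sub h4).congr' ?_ EventuallyEq.rfl
    filter_upwards [eventually_gt_atTop 0] with n hn
    have hn' : (0 : ℝ) < n := by exact_mod_cast hn
    have hb : 0 < 1 + β / ((n : ℝ) + 2) := by positivity
    have hprod : 0 < ρ * h n * (1 + x n) := by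
      have := mul_pos (hh (n + 1)) hb
      rw [hrec n] at this
      simpa [hx, div_eq_mul_inv, add_assoc] using this
    have hx1 : 0 < 1 + x n := (pos_iff_pos_of_mul_pos hprod).1 (mul_pos hρ (hh n))
    have hlog : Real.log (h (n + 1)) + Real.log (1 + β / ((n : ℝ) + 2)) =
        Real.log ρ + Real.log (h n) + Real.log (1 + x n) := by
      rw [← Real.log_mul (hh _).ne' hb.ne', hrec n, ← Real.log_mul hρ.ne' (hh n).ne',
        ← Real.log_mul (mul_pos hρ (hh n)).ne' hx1.ne']
      congr 1
      simp [hx, div_eq_mul_inv, add_assoc]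
    have hlogn : Real.log ((n : ℝ) + 1) = Real.log n + Real.log (1 + 1 / n) := by
      rw [← Real.log_mul hn'.ne' (by positivity)]
      congr 1
      field_simp
    have hxn : x n = γ * ((n : ℝ) + (1 : ℕ))⁻¹ + e n := rfl
    simp only [hg, Nat.cast_add, Nat.cast_one, hlogn, Nat.cast_zero, add_zero, Nat.cast_ofNat]
    generalize Real.log (1 + x n) = ℓ at hlog ⊢
    rw [hxn]
    simp only [div_eq_mul_inv, Nat.cast_one] at hlog ⊢
    linear_combination -hlog
  have hsum : Summable fun n => g (n + 1) - g n :=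
    summable_of_isBigO_nat (Real.summable_nat_pow_inv.2 one_lt_two) hgO
  have hlim : Tendsto g atTop (𝓝 (∑' n, (g (n + 1) - g n) + g 0)) := by
    have := hsum.hasSum.tendsto_sum_nat.add_const (g 0)
    simpa only [Finset.sum_range_sub, sub_add_cancel] using this
  obtain ⟨u, hu⟩ := hlim.bddAbove_range
  obtain ⟨l, hl⟩ := hlim.bddBelow_range
  have key : ∀ n : ℕ, 1 ≤ n → h n = Real.exp (g n) * (n : ℝ) ^ (γ - β) * ρ ^ n := by
    intro n hn
    have hn' : (0 : ℝ) < n := by exact_mod_cast hn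
    rw [Real.rpow_def_of_pos hn', ← Real.exp_log (pow_pos hρ n), Real.log_pow, ← Real.exp_add,
      ← Real.exp_add, ← Real.exp_log (hh n)]
    congr 1
    simp only [hg]
    ring
  refine ⟨Real.exp l, Real.exp u, Real.exp_pos _, Real.exp_pos _, fun n hn => ?_⟩
  have hgl : l ≤ g n := hl ⟨n, rfl⟩
  have hgu : g n ≤ u := hu ⟨n, rfl⟩
  rw [key n hn]
  constructor <;> gcongr

/-! ### Stationary sequences of the retrial queue -/

/-- `a i n` is a positive solution on `{0, …, L + 1} × ℕ` of the cut equations of the retrial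
queue with capacity `L + 1`: the cut between orbit sizes `n` and `n + 1`, and, at orbit size `n`,
the cut between `{C ≤ i}` and `{C > i}` refined by the orbit. -/
structure IsRetrialSolution (L : ℕ) (lam mu p : ℝ) (nu : ℕ → ℝ) (a : ℕ → ℕ → ℝ) : Prop where
  lam_pos : 0 < lam
  mu_pos : 0 < mu
  p_pos : 0 < p
  nu_zero : nu 0 = 0
  nu_pos : ∀ i ≤ L, 0 < nu (i + 1)
  pos : ∀ i ≤ L + 1, ∀ n, 0 < a i n
  cut : ∀ n : ℕ, lam * p * a (L + 1) n = (n + 1) * mu * ∑ j ∈ Finset.range (L + 1), a j (n + 1)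
  level : ∀ i ≤ L, ∀ n : ℕ, lam * a i n + n * mu * ∑ j ∈ Finset.range (i + 1), a j n =
    nu (i + 1) * a (i + 1) n + (n + 1) * mu * ∑ j ∈ Finset.range i, a j (n + 1)

namespace IsRetrialSolution

variable {L : ℕ} {lam mu p : ℝ} {nu : ℕ → ℝ} {a : ℕ → ℕ → ℝ}

theorem nu_nonneg (S : IsRetrialSolution L lam mu p nu a) {i : ℕ} (hi : i ≤ L + 1) :
    0 ≤ nu i := by
  rcases i with _ | i
  · exact S.nu_zero.ge
  · exact (S.nu_pos i (by omega)).le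

theorem sum_nonneg (S : IsRetrialSolution L lam mu p nu a) {m : ℕ} (hm : m ≤ L + 2) (n : ℕ) :
    0 ≤ ∑ j ∈ Finset.range m, a j n :=
  Finset.sum_nonneg fun j hj => (S.pos j (by have := Finset.mem_range.1 hj; omega) n).le

theorem le_sum (S : IsRetrialSolution L lam mu p nu a) {m : ℕ} (hm : m ≤ L + 1) (n : ℕ) :
    a m n ≤ ∑ j ∈ Finset.range (m + 1), a j n := by
  rw [Finset.sum_range_succ]
  linarith [S.sum_nonneg (m := m) (by omega) n]

/-- The cut equation, solved for the sum. -/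
theorem sum_eq (S : IsRetrialSolution L lam mu p nu a) (n : ℕ) :
    ∑ j ∈ Finset.range (L + 1), a j (n + 1) = lam * p / mu / (n + 1) * a (L + 1) n := by
  have := S.cut n
  have := S.mu_pos
  field_simp
  linarith

/-- With the cut equation inserted, the level equation at `i = L` says that the top level at `n + 1`
is fed by the top level at `n` and by level `L`, which the cut equation bounds by the former. The
remaining term has a favourable sign. -/
theorem exists_succ_le (S : IsRetrialSolution L lam mu p nu a) :
    ∃ C, 0 ≤ C ∧ ∀ n, a (L + 1) (n + 1) ≤ C * a (L + 1) n := by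
  have hν := S.nu_pos L le_rfl
  have := S.lam_pos; have := S.mu_pos; have := S.p_pos
  refine ⟨(lam * p + lam * (lam * p / mu)) / nu (L + 1), by positivity, fun n => ?_⟩
  have hE := S.level L le_rfl (n + 1)
  have hC := S.cut n
  have h1 := S.sum_nonneg (m := L) (by omega) (n + 1 + 1)
  have h2 : a L (n + 1) ≤ lam * p / mu * a (L + 1) n := by
    refine (S.le_sum (by omega) (n + 1)).trans ?_
    rw [S.sum_eq n]
    have := S.pos (L + 1) le_rfl n
    refine mul_le_mul_of_nonneg_right ?_ this.le
    exact div_le_self (by positivity) (by linarith [(Nat.cast_nonneg n : (0 : ℝ) ≤ n)])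
  push_cast at hE
  have h3 : 0 ≤ ((n : ℝ) + 1 + 1) * mu * ∑ j ∈ Finset.range L, a j (n + 1 + 1) := by positivity
  rw [div_mul_eq_mul_div, le_div_iff₀ hν]
  nlinarith [mul_le_mul_of_nonneg_left h2 S.lam_pos.le]

/-- Partial sums gain a factor `1 / n` for each level below the full one. -/
theorem exists_sum_mul_pow_le (S : IsRetrialSolution L lam mu p nu a) (k : ℕ) :
    ∀ m, m + (k + 1) ≤ L + 2 → ∃ C, 0 ≤ C ∧ ∀ n : ℕ,
      (∑ j ∈ Finset.range m, a j (n + 1)) * ((n : ℝ) + 1) ^ (k + 1) ≤ C * a (L + 1) n := by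
  have := S.lam_pos; have hμ := S.mu_pos; have := S.p_pos
  -- Double induction. The level equation at `m` bounds `n + 1` times the sum up to `m` by level `m
  -- + 1`, covered by exponent `k`, and by the shorter sum at the next orbit size, covered by the
  -- inner hypothesis and `exists_succ_le`.
  induction k with
  | zero =>
    intro m hm
    refine ⟨lam * p / mu, by positivity, fun n => ?_⟩
    have h1 : ∑ j ∈ Finset.range m, a j (n + 1) ≤ ∑ j ∈ Finset.range (L + 1), a j (n + 1) :=
      Finset.sum_le_sum_of_subset_of_nonneg (Finset.range_mono (by omega)) fun j hj _ =>
        (S.pos j (by have := Finset.mem_range.1 hj; omega) _).le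
    rw [S.sum_eq n] at h1
    calc _ ≤ lam * p / mu / (n + 1) * a (L + 1) n * ((n : ℝ) + 1) ^ (0 + 1) := by gcongr
      _ = _ := by field_simp; ring
  | succ k ihk =>
    intro m
    induction m with
    | zero => exact fun _ => ⟨0, le_rfl, fun n => by simp⟩
    | succ m ihm =>
      intro hm
      obtain ⟨C₁, hC₁, h₁⟩ := ihk (m + 2) (by omega)
      obtain ⟨C₂, hC₂, h₂⟩ := ihm (by omega)
      obtain ⟨C₃, hC₃, h₃⟩ := S.exists_succ_le
      have hν := S.nu_nonneg (i := m + 1) (by omega)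
      refine ⟨(nu (m + 1) * C₁ + mu * (C₂ * C₃)) / mu, by positivity, fun n => ?_⟩
      have hE := S.level m (by omega) (n + 1)
      have hpos := S.pos m (by omega) (n + 1)
      have ha : a (m + 1) (n + 1) * ((n : ℝ) + 1) ^ (k + 1) ≤ C₁ * a (L + 1) n :=
        le_trans (by gcongr; exact S.le_sum (by omega) _) (h₁ n)
      have hb : (∑ j ∈ Finset.range m, a j (n + 1 + 1)) * ((n : ℝ) + 1 + 1) *
          ((n : ℝ) + 1) ^ (k + 1) ≤ C₂ * (C₃ * a (L + 1) n) := by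
        have hs := S.sum_nonneg (m := m) (by omega) (n + 1 + 1)
        calc _ ≤ (∑ j ∈ Finset.range m, a j (n + 1 + 1)) * ((n : ℝ) + 1 + 1) *
              ((n : ℝ) + 1 + 1) ^ (k + 1) := by gcongr; linarith
          _ = (∑ j ∈ Finset.range m, a j (n + 1 + 1)) *
              (((n + 1 : ℕ) : ℝ) + 1) ^ (k + 1 + 1) := by push_cast; ring
          _ ≤ C₂ * a (L + 1) (n + 1) := h₂ (n + 1)
          _ ≤ _ := by gcongr; exact h₃ n
      have hE' : ((n : ℝ) + 1) * mu * ∑ j ∈ Finset.range (m + 1), a j (n + 1) ≤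
          nu (m + 1) * a (m + 1) (n + 1) +
            ((n : ℝ) + 1 + 1) * mu * ∑ j ∈ Finset.range m, a j (n + 1 + 1) := by
        push_cast at hE
        nlinarith [mul_pos S.lam_pos hpos]
      rw [div_mul_eq_mul_div, le_div_iff₀ hμ]
      have hq : (0 : ℝ) ≤ ((n : ℝ) + 1) ^ (k + 1) := by positivity
      have e1 := mul_le_mul_of_nonneg_right hE' hq
      have e2 := mul_le_mul_of_nonneg_left ha hν
      have e3 := mul_le_mul_of_nonneg_left hb hμ.le
      rw [pow_succ ((n : ℝ) + 1) (k + 1)]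
      linarith

/-- The reverse comparison: in the level equation at `i = L` the last term, a sum over levels below
`L`, is now bounded by the top level at `n + 1`. -/
theorem exists_le_succ (S : IsRetrialSolution L lam mu p nu a) :
    ∃ C, 0 ≤ C ∧ ∀ n, a (L + 1) n ≤ C * a (L + 1) (n + 1) := by
  have hν := S.nu_pos L le_rfl
  have := S.lam_pos; have hμ := S.mu_pos; have := S.p_pos
  obtain ⟨C, hC, h⟩ := S.exists_sum_mul_pow_le 0 L (by omega)
  refine ⟨(nu (L + 1) + mu * C) / (lam * p), by positivity, fun n => ?_⟩
  have hE := S.level L le_rfl (n + 1)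
  have hcut := S.cut n
  have h1 := h (n + 1)
  have h2 := S.pos L (by omega) (n + 1)
  push_cast at hE h1
  rw [div_mul_eq_mul_div, le_div_iff₀ (by positivity)]
  have e1 := mul_le_mul_of_nonneg_left h1 hμ.le
  rw [pow_one] at e1
  nlinarith [mul_pos S.lam_pos h2]

/-- The one-step recursion of the top level, with a relative error of order `n⁻²`. -/
theorem exists_abs_recursion_le (S : IsRetrialSolution L lam mu p nu a) :
    ∃ C, ∀ n : ℕ,
      |nu (L + 1) * a (L + 1) (n + 1) - lam * p * a (L + 1) n
        - lam * (lam * p / mu) / (n + 1) * a (L + 1) n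
        + nu L * (lam * p / mu) / (n + 2) * a (L + 1) (n + 1)| ≤
      C / ((n : ℝ) + 1) ^ 2 * a (L + 1) n := by
  have hl := S.lam_pos; have hμ := S.mu_pos; have := S.p_pos
  have hνL := S.nu_nonneg (i := L) (by omega)
  obtain ⟨U, hU, hup⟩ := S.exists_succ_le
  obtain ⟨C₁, hC₁, h₁⟩ := S.exists_sum_mul_pow_le 1 L (by omega)
  have hx : ∀ n : ℕ, ∑ j ∈ Finset.range L, a j (n + 1) ≤
      C₁ / ((n : ℝ) + 1) ^ 2 * a (L + 1) n := fun n => by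
    rw [div_mul_eq_mul_div, le_div_iff₀ (by positivity)]
    exact h₁ n
  have hx' : ∀ n : ℕ, ∑ j ∈ Finset.range L, a j (n + 1 + 1) ≤
      C₁ * U / ((n : ℝ) + 1) ^ 2 * a (L + 1) n := fun n => by
    have h0 := S.pos (L + 1) le_rfl n
    calc _ ≤ C₁ / (((n + 1 : ℕ) : ℝ) + 1) ^ 2 * a (L + 1) (n + 1) := hx (n + 1)
      _ ≤ C₁ / ((n : ℝ) + 1) ^ 2 * (U * a (L + 1) n) := by
        have h0' := S.pos (L + 1) le_rfl (n + 1)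
        gcongr
        · omega
        · exact hup n
      _ = _ := by ring
  -- The retrial flow from below level `L` nearly balances the service flow `nu L * a L`, and `a L`
  -- is nearly the full sum given by the cut equation. For `L = 0` both sides vanish since `nu 0 =
  -- 0`.
  obtain ⟨C₂, hC₂, h₂⟩ : ∃ C, 0 ≤ C ∧ ∀ n : ℕ,
      |((n : ℝ) + 2) * mu * ∑ j ∈ Finset.range L, a j (n + 1 + 1)
        - nu L * (lam * p / mu) / (n + 2) * a (L + 1) (n + 1)| ≤
      C / ((n : ℝ) + 1) ^ 2 * a (L + 1) n := by
    rcases L with _ | L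
    · exact ⟨0, le_rfl, fun n => by simp [S.nu_zero]⟩
    obtain ⟨C₃, hC₃, h₃⟩ := S.exists_sum_mul_pow_le 2 L (by omega)
    refine ⟨nu (L + 1) * (C₁ * U) + mu * (C₃ * U * U) + lam * (C₁ * U), by positivity,
      fun n => ?_⟩
    have h0 := S.pos (L + 1 + 1) le_rfl n
    have h0' := S.pos (L + 1 + 1) le_rfl (n + 1)
    have h0'' := S.pos (L + 1 + 1) le_rfl (n + 1 + 1)
    have hE := S.level L (by omega) (n + 1 + 1)
    have hs := S.sum_eq (n + 1)
    rw [Finset.sum_range_succ] at hs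
    have b1 := hx' n
    have b0 := S.sum_nonneg (m := L + 1) (by omega) (n + 1 + 1)
    have b2 : a L (n + 1 + 1) ≤ _ := (S.le_sum (by omega) _).trans b1
    have b2' := S.pos L (by omega) (n + 1 + 1)
    have b3 : ((n : ℝ) + 3) * ∑ j ∈ Finset.range L, a j (n + 1 + 1 + 1) ≤
        C₃ * U * U / ((n : ℝ) + 1) ^ 2 * a (L + 1 + 1) n := by
      have h3 := h₃ (n + 1 + 1)
      have hn0 := S.sum_nonneg (m := L) (by omega) (n + 1 + 1 + 1)
      rw [div_mul_eq_mul_div, le_div_iff₀ (by positivity)]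
      calc _ ≤ ((n : ℝ) + 3) * (∑ j ∈ Finset.range L, a j (n + 1 + 1 + 1)) *
            ((n : ℝ) + 3) ^ 2 := by gcongr; linarith
        _ = (∑ j ∈ Finset.range L, a j (n + 1 + 1 + 1)) *
            (((n + 1 + 1 : ℕ) : ℝ) + 1) ^ (2 + 1) := by push_cast; ring
        _ ≤ C₃ * a (L + 1 + 1) (n + 1 + 1) := h3
        _ ≤ C₃ * (U * (U * a (L + 1 + 1) n)) := by
          gcongr
          exact (hup (n + 1)).trans (by gcongr; exact hup n)
        _ = _ := by ring
    have b3' : 0 ≤ ((n : ℝ) + 3) * ∑ j ∈ Finset.range L, a j (n + 1 + 1 + 1) :=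
      mul_nonneg (by positivity) (S.sum_nonneg (by omega) _)
    have key : ((n : ℝ) + 2) * mu * ∑ j ∈ Finset.range (L + 1), a j (n + 1 + 1)
        - nu (L + 1) * (lam * p / mu) / (n + 2) * a (L + 1 + 1) (n + 1) =
        - (nu (L + 1) * ∑ j ∈ Finset.range (L + 1), a j (n + 1 + 1))
        + mu * (((n : ℝ) + 3) * ∑ j ∈ Finset.range L, a j (n + 1 + 1 + 1))
        - lam * a L (n + 1 + 1) := by
      push_cast at hE hs
      have e : (n : ℝ) + 1 + 1 = n + 2 := by ring
      rw [e] at hE hs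
      rw [mul_div_assoc, mul_assoc (nu (L + 1)), ← hs]
      linear_combination hE
    rw [key, abs_le]
    have c1 := mul_le_mul_of_nonneg_left b1 hνL
    have c2 := mul_le_mul_of_nonneg_left b2 hl.le
    have c3 := mul_le_mul_of_nonneg_left b3 hμ.le
    have c1' := mul_nonneg hνL b0
    have c2' := mul_nonneg hl.le b2'.le
    have c3' := mul_nonneg hμ.le b3'
    have e : (nu (L + 1) * (C₁ * U) + mu * (C₃ * U * U) + lam * (C₁ * U)) / ((n : ℝ) + 1) ^ 2 *
        a (L + 1 + 1) n = nu (L + 1) * (C₁ * U / ((n : ℝ) + 1) ^ 2 * a (L + 1 + 1) n) +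
        mu * (C₃ * U * U / ((n : ℝ) + 1) ^ 2 * a (L + 1 + 1) n) +
        lam * (C₁ * U / ((n : ℝ) + 1) ^ 2 * a (L + 1 + 1) n) := by ring
    rw [e]
    constructor <;> linarith
  refine ⟨lam * C₁ + C₂, fun n => ?_⟩
  have hE := S.level L le_rfl (n + 1)
  have hcut := S.cut n
  have hs := S.sum_eq n
  rw [Finset.sum_range_succ] at hs
  -- Level equation at `i = L`, with `a L (n + 1)` written as the full sum minus the lower levels;
  -- the latter are `O(n⁻²)`.
  have key : nu (L + 1) * a (L + 1) (n + 1) - lam * p * a (L + 1) n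
        - lam * (lam * p / mu) / (n + 1) * a (L + 1) n
        + nu L * (lam * p / mu) / (n + 2) * a (L + 1) (n + 1) =
      -(lam * ∑ j ∈ Finset.range L, a j (n + 1)) -
      (((n : ℝ) + 2) * mu * ∑ j ∈ Finset.range L, a j (n + 1 + 1)
        - nu L * (lam * p / mu) / (n + 2) * a (L + 1) (n + 1)) := by
    push_cast at hE
    rw [mul_div_assoc lam, mul_assoc lam (_ / _), ← hs]
    linear_combination -hcut - hE
  have c1 := mul_le_mul_of_nonneg_left (hx n) hl.le
  have c1' := mul_nonneg hl.le (S.sum_nonneg (m := L) (by omega) (n + 1))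
  rw [key, abs_le]
  have c2 := abs_le.1 (h₂ n)
  have e : (lam * C₁ + C₂) / ((n : ℝ) + 1) ^ 2 * a (L + 1) n =
      lam * (C₁ / ((n : ℝ) + 1) ^ 2 * a (L + 1) n) + C₂ / ((n : ℝ) + 1) ^ 2 * a (L + 1) n := by
    ring
  rw [e]
  constructor <;> linarith [c2.1, c2.2]

/-- The exact order of the top level. -/
theorem exists_bounds_top (S : IsRetrialSolution L lam mu p nu a) :
    ∃ D₁ D₂ : ℝ, 0 < D₁ ∧ 0 < D₂ ∧ ∀ n : ℕ, 1 ≤ n →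
      D₁ * (n : ℝ) ^ (lam / mu - nu L * (lam * p / mu) / nu (L + 1)) *
        (lam * p / nu (L + 1)) ^ n ≤ a (L + 1) n ∧
      a (L + 1) n ≤ D₂ * (n : ℝ) ^ (lam / mu - nu L * (lam * p / mu) / nu (L + 1)) *
        (lam * p / nu (L + 1)) ^ n := by
  have hl := S.lam_pos; have hμ := S.mu_pos; have hp := S.p_pos
  have hν := S.nu_pos L le_rfl
  have hνL := S.nu_nonneg (i := L) (by omega)
  obtain ⟨C, hC⟩ := S.exists_abs_recursion_le
  set r : ℕ → ℝ := fun n => nu (L + 1) * a (L + 1) (n + 1) - lam * p * a (L + 1) n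
        - lam * (lam * p / mu) / (n + 1) * a (L + 1) n
        + nu L * (lam * p / mu) / (n + 2) * a (L + 1) (n + 1) with hr
  -- Dividing the recursion by `nu (L + 1)` gives `γ = lam / mu` and `β = nu L * (lam * p / mu) / nu
  -- (L + 1)`, whose difference is `α`.
  refine exists_bounds_of_ratio (e := fun n => r n / (lam * p * a (L + 1) n))
    (C := C / (lam * p)) (S.pos (L + 1) le_rfl) (by positivity) (by positivity)
    (fun n => ?_) (fun n => ?_)
  · have h0 := S.pos (L + 1) le_rfl n
    rw [abs_div, abs_of_pos (show 0 < lam * p * a (L + 1) n by positivity),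
      div_le_iff₀ (by positivity)]
    refine (hC n).trans (le_of_eq ?_)
    field_simp
  · have h0 := S.pos (L + 1) le_rfl n
    simp only [hr]
    field_simp
    ring

theorem exists_mul_succ_le (S : IsRetrialSolution L lam mu p nu a) {i : ℕ} (hi : i ≤ L) :
    ∃ D, 0 < D ∧ ∀ n : ℕ, 1 ≤ n → D * a (i + 1) n ≤ n * a i n := by
  have hl := S.lam_pos; have hμ := S.mu_pos
  have hν := S.nu_pos i hi
  have hνi := S.nu_nonneg (i := i) (by omega)
  refine ⟨nu (i + 1) / (lam + mu + nu i), by positivity, fun n hn => ?_⟩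
  have hn' : (1 : ℝ) ≤ n := by exact_mod_cast hn
  have h0 := S.pos i (by omega) n
  -- The difference of two consecutive level equations is global balance at `(i, n)`; only the
  -- inflow by service is kept.
  have key : nu (i + 1) * a (i + 1) n ≤ (lam + n * mu + nu i) * a i n := by
    have hE := S.level i hi n
    rcases i with _ | i
    · simp at hE
      rw [S.nu_zero]
      simp
      linarith
    · have hE' := S.level i (by omega) n
      rw [Finset.sum_range_succ] at hE
      rw [Finset.sum_range_succ (fun j => a j (n + 1))] at hE
      have h1 := S.pos i (by omega) n
      have h2 := S.pos i (by omega) (n + 1)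
      have h3 : 0 ≤ ((n : ℝ) + 1) * mu * a i (n + 1) := by positivity
      nlinarith [mul_pos hl h1]
  rw [div_mul_eq_mul_div, div_le_iff₀ (by positivity)]
  refine key.trans ?_
  have : lam + n * mu + nu i ≤ n * (lam + mu + nu i) := by nlinarith
  nlinarith

theorem exists_top_le (S : IsRetrialSolution L lam mu p nu a) (k : ℕ) (hk : k ≤ L + 1) :
    ∃ D, 0 < D ∧ ∀ n : ℕ, 1 ≤ n → D * a (L + 1) n ≤ (n : ℝ) ^ k * a (L + 1 - k) n := by
  induction k with
  | zero => exact ⟨1, one_pos, fun n _ => by simp⟩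
  | succ k ih =>
    obtain ⟨D, hD, h⟩ := ih (by omega)
    obtain ⟨D', hD', h'⟩ := S.exists_mul_succ_le (i := L + 1 - (k + 1)) (by omega)
    refine ⟨D' * D, by positivity, fun n hn => ?_⟩
    have e : L + 1 - (k + 1) + 1 = L + 1 - k := by omega
    have h1 := h' n hn
    rw [e] at h1
    calc D' * D * a (L + 1) n = D' * (D * a (L + 1) n) := by ring
      _ ≤ D' * ((n : ℝ) ^ k * a (L + 1 - k) n) := mul_le_mul_of_nonneg_left (h n hn) hD'.le
      _ = (n : ℝ) ^ k * (D' * a (L + 1 - k) n) := by ring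
      _ ≤ (n : ℝ) ^ k * (n * a (L + 1 - (k + 1)) n) := by gcongr
      _ = _ := by ring

/-- The partial-sum bound compares orbit size `n + 1` with the top level at `n`; `exists_le_succ`
removes this shift. -/
theorem exists_le_top (S : IsRetrialSolution L lam mu p nu a) (k : ℕ) (hk : 1 ≤ k)
    (hkL : k ≤ L + 1) :
    ∃ D, 0 < D ∧ ∀ n : ℕ, 1 ≤ n → (n : ℝ) ^ k * a (L + 1 - k) n ≤ D * a (L + 1) n := by
  obtain ⟨k, rfl⟩ := Nat.exists_eq_add_of_le' hk
  obtain ⟨C, hC, h⟩ := S.exists_sum_mul_pow_le k (L + 1 - (k + 1) + 1) (by omega)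
  obtain ⟨C', hC', h'⟩ := S.exists_le_succ
  refine ⟨C * C' + 1, by positivity, fun n hn => ?_⟩
  obtain ⟨n, rfl⟩ := Nat.exists_eq_add_of_le' hn
  have h0 := S.pos (L + 1) le_rfl (n + 1)
  calc _ = a (L + 1 - (k + 1)) (n + 1) * ((n : ℝ) + 1) ^ (k + 1) := by push_cast; ring
    _ ≤ (∑ j ∈ Finset.range (L + 1 - (k + 1) + 1), a j (n + 1)) * ((n : ℝ) + 1) ^ (k + 1) := by
      gcongr
      exact S.le_sum (by omega) _
    _ ≤ C * a (L + 1) n := h n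
    _ ≤ C * (C' * a (L + 1) (n + 1)) := by gcongr; exact h' n
    _ ≤ _ := by nlinarith

/-- The exact order of every level below the top one. -/
theorem exists_bounds (S : IsRetrialSolution L lam mu p nu a) (k : ℕ) (hk : 1 ≤ k)
    (hkL : k ≤ L + 1) :
    ∃ D₁ D₂ : ℝ, 0 < D₁ ∧ 0 < D₂ ∧ ∀ n : ℕ, 1 ≤ n →
      D₁ * (n : ℝ) ^ (lam / mu - nu L * (lam * p / mu) / nu (L + 1) - k) *
        (lam * p / nu (L + 1)) ^ n ≤ a (L + 1 - k) n ∧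
      a (L + 1 - k) n ≤ D₂ * (n : ℝ) ^ (lam / mu - nu L * (lam * p / mu) / nu (L + 1) - k) *
        (lam * p / nu (L + 1)) ^ n := by
  obtain ⟨D₁, D₂, hD₁, hD₂, h⟩ := S.exists_bounds_top
  obtain ⟨E₁, hE₁, h₁⟩ := S.exists_top_le k hkL
  obtain ⟨E₂, hE₂, h₂⟩ := S.exists_le_top k hk hkL
  refine ⟨E₁ * D₁, E₂ * D₂, by positivity, by positivity, fun n hn => ?_⟩
  have hn' : (0 : ℝ) < n := by exact_mod_cast hn
  set s := lam / mu - nu L * (lam * p / mu) / nu (L + 1)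
  have e : ∀ D : ℝ, D * (n : ℝ) ^ (s - k) * (lam * p / nu (L + 1)) ^ n =
      D * (n : ℝ) ^ s * (lam * p / nu (L + 1)) ^ n / (n : ℝ) ^ k := fun D => by
    rw [Real.rpow_sub_natCast hn'.ne']
    ring
  rw [e, e, div_le_iff₀ (by positivity), le_div_iff₀ (by positivity)]
  obtain ⟨hl, hu⟩ := h n hn
  have h1 := h₁ n hn
  have h2 := h₂ n hn
  constructor
  · nlinarith [mul_le_mul_of_nonneg_left hl hE₁.le]
  · nlinarith [mul_le_mul_of_nonneg_left hu hE₂.le]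

end IsRetrialSolution

/-! ### Limits of transition functions -/

section Limit

variable {S : Type*} [DecidableEq S] {Q : S → S → ℝ} {P : ℝ≥0 → S → S → ℝ} {w : S → ℝ}

theorem IsTransitionFunction.le_one (hP : IsTransitionFunction Q P) (t : ℝ≥0) (x y : S) :
    P t x y ≤ 1 := by
  rw [← (hP.hasSum_one t x).tsum_eq]
  exact (hP.hasSum_one t x).summable.le_tsum y fun z _ => hP.nonneg t x z

theorem IsTransitionFunction.limit_nonneg (hP : IsTransitionFunction Q P)
    (hw : ∀ x y, Tendsto (fun t => P t x y) atTop (𝓝 (w y))) (y : S) : 0 ≤ w y :=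
  ge_of_tendsto' (hw y y) fun t => hP.nonneg t y y

/-- A limit of the transition probabilities is subinvariant. -/
theorem IsTransitionFunction.sum_limit_mul_le (hP : IsTransitionFunction Q P)
    (hw : ∀ x y, Tendsto (fun t => P t x y) atTop (𝓝 (w y))) (t : ℝ≥0) (F : Finset S) (y : S) :
    ∑ x ∈ F, w x * P t x y ≤ w y := by
  -- Restricting to finite `F` avoids exchanging limit and infinite sum, at the price of an
  -- inequality.
  have h1 : Tendsto (fun s => ∑ x ∈ F, P s y x * P t x y) atTop (𝓝 (∑ x ∈ F, w x * P t x y)) :=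
    tendsto_finsetSum _ fun x _ => (hw y x).mul_const _
  have h2 : Tendsto (fun s => P (s + t) y y) atTop (𝓝 (w y)) :=
    (hw y y).comp (tendsto_atTop_mono (fun _ => le_self_add) tendsto_id)
  refine le_of_tendsto_of_tendsto' h1 h2 fun s => ?_
  exact sum_le_hasSum F (fun z _ => mul_nonneg (hP.nonneg s y z) (hP.nonneg t z y))
    (hP.chapman_kolmogorov s t y y)

/-- A limit of the transition probabilities is subinvariant for the generator. -/
theorem IsTransitionFunction.sum_limit_mul_generator_le (hP : IsTransitionFunction Q P)
    (hw : ∀ x y, Tendsto (fun t => P t x y) atTop (𝓝 (w y))) {F : Finset S} {y : S}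
    (hy : y ∈ F) : ∑ x ∈ F, w x * Q x y ≤ 0 := by
  have h1 : Tendsto (fun t : ℝ≥0 => ∑ x ∈ F, w x * ((P t x y - P 0 x y) / (t : ℝ))) (𝓝[>] 0)
      (𝓝 (∑ x ∈ F, w x * Q x y)) :=
    tendsto_finsetSum _ fun x _ => (hP.deriv_zero x y).const_mul _
  refine le_of_tendsto' h1 fun t => ?_
  have h2 : ∑ x ∈ F, w x * ((P t x y - P 0 x y) / (t : ℝ)) =
      (∑ x ∈ F, w x * P t x y - w y) / t := by
    have h3 : ∑ x ∈ F, w x * P 0 x y = w y := by simp [hP.zero, hy]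
    rw [← h3, ← Finset.sum_sub_distrib, Finset.sum_div]
    exact Finset.sum_congr rfl fun x _ => by ring
  rw [h2]
  exact div_nonpos_of_nonpos_of_nonneg (sub_nonpos.2 (hP.sum_limit_mul_le hw t F y)) t.2

theorem IsTransitionFunction.limit_pos (hP : IsTransitionFunction Q P) (hE : IsErgodic P)
    (hw1 : HasSum w 1) (hw : ∀ x y, Tendsto (fun t => P t x y) atTop (𝓝 (w y))) (y : S) :
    0 < w y := by
  obtain ⟨x, hx⟩ : ∃ x, w x ≠ 0 := by
    by_contra! h
    have : w = fun _ => 0 := funext h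
    rw [this] at hw1
    exact one_ne_zero (hw1.unique hasSum_zero)
  obtain ⟨t, ht⟩ := hE.irreducible x y
  have h := hP.sum_limit_mul_le hw t {x} y
  rw [Finset.sum_singleton] at h
  exact (mul_pos ((hP.limit_nonneg hw x).lt_of_ne' hx) ht).trans_le h

/-- The law of an ergodic Markov chain converges to the limit of its transition probabilities,
whatever the initial law. -/
theorem IsMarkovChain.tendsto_real [Countable S] [MeasurableSpace S] [MeasurableSingletonClass S]
    {Ω : Type*} [MeasurableSpace Ω] {ℙ : Measure Ω} [IsProbabilityMeasure ℙ] {X : ℝ≥0 → Ω → S}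
    (hX : IsMarkovChain P ℙ X) (hP : IsTransitionFunction Q P)
    (hw : ∀ x y, Tendsto (fun t => P t x y) atTop (𝓝 (w y))) (y : S) :
    Tendsto (fun t => ℙ.real {ω | X t ω = y}) atTop (𝓝 (w y)) := by
  have hmeas : ∀ t x, MeasurableSet {ω | X t ω = x} := fun t x =>
    hX.measurable t (measurableSet_singleton x)
  have htwo : ∀ t x, ℙ.real ({ω | X 0 ω = x} ∩ {ω | X t ω = y}) =
      ℙ.real {ω | X 0 ω = x} * P t x y := by
    intro t x
    have h := hX.finite_dim 1 ![0, t] (by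
      intro i j hij
      fin_cases i <;> fin_cases j <;> simp at hij ⊢) ![x, y]
    simpa [Fin.forall_fin_two, Set.ofPred_and] using h
  have hpart : ∀ A : Set Ω, MeasurableSet A →
      HasSum (fun x => ℙ.real ({ω | X 0 ω = x} ∩ A)) (ℙ.real A) := by
    intro A hA
    have hU : A = ⋃ x, {ω | X 0 ω = x} ∩ A := by ext ω; simp
    have h := measure_iUnion (μ := ℙ) (f := fun x => {ω | X 0 ω = x} ∩ A)
      (fun x x' hxx' => Set.disjoint_left.2 fun ω h h' => hxx' (h.1.symm.trans h'.1))
      fun x => (hmeas 0 x).inter hA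
    rw [← hU] at h
    have hfin : ∑' x, ℙ ({ω | X 0 ω = x} ∩ A) ≠ ⊤ := h ▸ measure_ne_top ℙ A
    have := ENNReal.hasSum_toReal hfin
    rwa [← ENNReal.tsum_toReal_eq fun x => measure_ne_top ℙ _, ← h] at this
  have hinit : HasSum (fun x => ℙ.real {ω | X 0 ω = x}) 1 := by
    simpa using hpart Set.univ MeasurableSet.univ
  have hlaw : ∀ t, ℙ.real {ω | X t ω = y} = ∑' x, ℙ.real {ω | X 0 ω = x} * P t x y := fun t => by
    rw [← (hpart _ (hmeas t y)).tsum_eq]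
    exact tsum_congr fun x => htwo t x
  have hlim : w y = ∑' x, ℙ.real {ω | X 0 ω = x} * w y := by
    rw [tsum_mul_right, hinit.tsum_eq, one_mul]
  rw [funext hlaw, hlim]
  -- The initial law dominates, as transition probabilities are at most `1`.
  refine tendsto_tsum_of_dominated_convergence hinit.summable
    (fun x => (hw x y).const_mul _) (Eventually.of_forall fun t x => ?_)
  rw [Real.norm_of_nonneg (mul_nonneg measureReal_nonneg (hP.nonneg t x y))]
  exact mul_le_of_le_one_right measureReal_nonneg (hP.le_one t x y)

end Limit

/-! ### From global to cut balance -/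

/-- Subinvariance at every state forces the cut equations, since no mass escapes through large
orbits. -/
theorem isRetrialSolution_of_balance {L : ℕ} {lam mu p : ℝ} {nu : ℕ → ℝ} {a : ℕ → ℕ → ℝ}
    (hlam : 0 < lam) (hmu : 0 < mu) (hp : 0 ≤ p) (hnu0 : nu 0 = 0)
    (hnu : ∀ i ≤ L, nu i ≤ nu (i + 1)) (hpos : ∀ i ≤ L + 1, ∀ n, 0 < a i n)
    (hlim : Tendsto (a (L + 1)) atTop (𝓝 0))
    (hbot : ∀ n : ℕ, nu 1 * a 1 n ≤ (lam + n * mu) * a 0 n)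
    (hmid : ∀ i < L, ∀ n : ℕ, lam * a i n + nu (i + 2) * a (i + 2) n
      + (n + 1) * mu * a i (n + 1) ≤ (lam + n * mu + nu (i + 1)) * a (i + 1) n)
    (htop0 : lam * a L 0 + mu * a L 1 ≤ (lam * p + nu (L + 1)) * a (L + 1) 0)
    (htop : ∀ n : ℕ, lam * a L (n + 1) + (n + 2) * mu * a L (n + 2) + lam * p * a (L + 1) n ≤
      (lam * p + nu (L + 1)) * a (L + 1) (n + 1)) :
    IsRetrialSolution L lam mu p nu a := by
  -- Net outflow of `{0, …, i} × {n}`, which is the accumulated slack of the balance inequalities at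
  -- `(0, n), …, (i, n)`; hence nonnegative and increasing in `i`.
  set d : ℕ → ℕ → ℝ := fun i n => lam * a i n + n * mu * ∑ j ∈ Finset.range (i + 1), a j n
    - nu (i + 1) * a (i + 1) n - (n + 1) * mu * ∑ j ∈ Finset.range i, a j (n + 1) with hd
  have hd0 : ∀ n, 0 ≤ d 0 n := fun n => by
    simp only [hd, zero_add, Finset.sum_range_one, Finset.sum_range_zero]
    linarith [hbot n]
  have hdsucc : ∀ i < L, ∀ n, d i n ≤ d (i + 1) n := fun i hi n => by
    simp only [hd]
    rw [Finset.sum_range_succ _ (i + 1), Finset.sum_range_succ (fun j => a j (n + 1)) i]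
    linarith [hmid i hi n]
  have hdnonneg : ∀ i ≤ L, ∀ n, 0 ≤ d i n := by
    intro i hi n
    induction i with
    | zero => exact hd0 n
    | succ i ih => exact (ih (by omega)).trans (hdsucc i (by omega) n)
  -- Net upward flow from orbit size `n` to `n + 1`. Its increments dominate `d L ≥ 0`, so it is
  -- nonnegative and nondecreasing, while it is at most `lam * p * a (L + 1) n`, which tends to `0`.
  -- Hence it vanishes identically, and every slack with it.
  set T : ℕ → ℝ := fun n => lam * p * a (L + 1) n
    - (n + 1) * mu * ∑ j ∈ Finset.range (L + 1), a j (n + 1) with hT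
  have hT0 : d L 0 ≤ T 0 := by
    simp only [hd, hT]
    rw [Finset.sum_range_succ (fun j => a j (0 + 1)) L]
    push_cast
    linarith [htop0]
  have hTsucc : ∀ n, d L (n + 1) ≤ T (n + 1) - T n := fun n => by
    simp only [hd, hT]
    rw [Finset.sum_range_succ (fun j => a j (n + 1 + 1)) L]
    push_cast
    have e : (n : ℝ) + 1 + 1 = n + 2 := by ring
    rw [e]
    linarith [htop n]
  have hTmono : Monotone T := monotone_nat_of_le_succ fun n => by
    linarith [hTsucc n, hdnonneg L le_rfl (n + 1)]
  have hTnonneg : ∀ n, 0 ≤ T n := fun n =>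
    ((hdnonneg L le_rfl 0).trans hT0).trans (hTmono (Nat.zero_le n))
  have hTle : ∀ n, T n ≤ lam * p * a (L + 1) n := fun n => by
    have : 0 ≤ ∑ j ∈ Finset.range (L + 1), a j (n + 1) :=
      Finset.sum_nonneg fun j hj => (hpos j (Finset.mem_range.1 hj).le _).le
    have : 0 ≤ ((n : ℝ) + 1) * mu * ∑ j ∈ Finset.range (L + 1), a j (n + 1) := by positivity
    simp only [hT]
    linarith
  have hTzero : ∀ n, T n = 0 := fun n => by
    refine le_antisymm ?_ (hTnonneg n)
    have h : Tendsto (fun m => lam * p * a (L + 1) m) atTop (𝓝 0) := by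
      simpa using hlim.const_mul (lam * p)
    exact ge_of_tendsto h ((eventually_ge_atTop n).mono fun m hm => (hTmono hm).trans (hTle m))
  have hdL : ∀ n, d L n ≤ 0 := by
    rintro (_ | n)
    · exact hT0.trans (hTzero 0).le
    · simpa [hTzero] using hTsucc n
  have hdle : ∀ j, ∀ i, i + j = L → ∀ n, d i n ≤ 0 := by
    intro j
    induction j with
    | zero => rintro i rfl n; exact hdL n
    | succ j ih => exact fun i hi n => (hdsucc i (by omega) n).trans (ih (i + 1) (by omega) n)
  have hd_eq : ∀ i ≤ L, ∀ n, d i n = 0 := fun i hi n =>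
    le_antisymm (hdle (L - i) i (by omega) n) (hdnonneg i hi n)
  have hcut : ∀ n : ℕ, lam * p * a (L + 1) n =
      (n + 1) * mu * ∑ j ∈ Finset.range (L + 1), a j (n + 1) := fun n => sub_eq_zero.1 (hTzero n)
  have hnu1 : 0 < nu 1 := by
    have h := hd_eq 0 (by omega) 0
    simp only [hd, zero_add, Finset.sum_range_one, Finset.sum_range_zero, CharP.cast_eq_zero,
      zero_mul, add_zero, mul_zero, sub_zero] at h
    have h0 := mul_pos hlam (hpos 0 (by omega) 0)
    rw [sub_eq_zero.1 h] at h0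
    exact (pos_iff_pos_of_mul_pos h0).2 (hpos 1 (by omega) 0)
  refine ⟨hlam, hmu, ?_, hnu0, ?_, hpos, hcut, fun i hi n => ?_⟩
  -- If `p = 0`, the cut equation at `n = 0` would make a positive downward flow vanish.
  · refine hp.lt_of_ne fun hp0 => ?_
    have h := hcut 0
    have : 0 < ∑ j ∈ Finset.range (L + 1), a j (0 + 1) :=
      Finset.sum_pos (fun j hj => hpos j (Finset.mem_range.1 hj).le _) (by simp)
    rw [← hp0] at h
    have h' : 0 < (((0 : ℕ) : ℝ) + 1) * mu * ∑ j ∈ Finset.range (L + 1), a j (0 + 1) := by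
      positivity
    rw [← h] at h'
    simp at h'
  · intro i hi
    induction i with
    | zero => exact hnu1
    | succ i ih => exact (ih (by omega)).trans_le (hnu (i + 1) hi)
  · have := hd_eq i hi n
    simp only [hd] at this
    linarith

/-! ### The retrial queue -/

/-- The limit of an ergodic transition function of the retrial queue without abandonment solves
the cut equations. -/
theorem RetrialQueue.isRetrialSolution (M : RetrialQueue) (hq : M.q = 1) (hr : M.r = 1)
    {P : ℝ≥0 → M.State → M.State → ℝ} (hP : IsTransitionFunction M.generator P)
    (hErg : IsErgodic P) {w : M.State → ℝ} (hw1 : HasSum w 1)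
    (hw : ∀ x y, Tendsto (fun t => P t x y) atTop (𝓝 (w y))) {L : ℕ} (hL : M.K = L + 1) :
    IsRetrialSolution L M.lam M.mu M.p M.nu
      -- The default value `0` is never met: the cut equations involve only levels up to `L + 1 =
      -- M.K`.
      fun i n => if h : i < M.K + 1 then w (⟨i, h⟩, n) else 0 := by
  have hbal := fun (F : Finset M.State) y (hy : y ∈ F) => hP.sum_limit_mul_generator_le hw hy
  have hLK : L < M.K + 1 := by omega
  have hKK : L + 1 < M.K + 1 := by omega
  have hwpos := hP.limit_pos hErg hw1 hw
  refine isRetrialSolution_of_balance M.lam_pos M.mu_pos M.p_mem.1 M.nu_zero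
    (fun i hi => M.nu_mono i (by omega)) (fun i hi n => ?_) ?_ (fun n => ?_) (fun i hi n => ?_)
    ?_ (fun n => ?_)
  · have hi' : i < M.K + 1 := by omega
    simpa [hi'] using hwpos _
  · simp only [hKK, dif_pos]
    have hinj : Function.Injective fun n : ℕ => ((⟨L + 1, hKK⟩, n) : M.State) :=
      fun _ _ h => (Prod.mk.inj h).2
    rw [← Nat.cofinite_eq_atTop]
    exact (hw1.summable.comp_injective hinj).tendsto_cofinite_zero
  · have h0 : 0 < M.K + 1 := by omega
    have h1 : 1 < M.K + 1 := by omega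
    have hK0 : (0 : ℕ) ≠ M.K := by omega
    -- In each case the finite set consists of the target state and all states with a positive rate
    -- into it. At the top level, orbit size `0` is separate because there is no inflow from a
    -- smaller orbit.
    have h := hbal {(⟨0, h0⟩, n), (⟨1, h1⟩, n)} (⟨0, h0⟩, n) (by simp)
    rw [Finset.sum_insert (by simp), Finset.sum_singleton] at h
    simp [RetrialQueue.generator, RetrialQueue.Q1, hK0, M.nu_zero] at h
    simp only [h0, h1, dif_pos, Fin.zero_eta]
    linarith
  · have h0 : i < M.K + 1 := by omega
    have h1 : i + 1 < M.K + 1 := by omega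
    have h2 : i + 2 < M.K + 1 := by omega
    have hK1 : i + 1 ≠ M.K := by omega
    have hn : n ≠ n + 1 + 1 := by omega
    have h := hbal {(⟨i + 1, h1⟩, n), (⟨i, h0⟩, n), (⟨i + 2, h2⟩, n), (⟨i, h0⟩, n + 1)}
      (⟨i + 1, h1⟩, n) (by simp)
    rw [Finset.sum_insert (by simp), Finset.sum_insert (by simp), Finset.sum_insert (by simp),
      Finset.sum_singleton] at h
    simp [RetrialQueue.generator, RetrialQueue.Q1, RetrialQueue.Q2, hK1, hn, hr, hq] at h
    simp only [h0, h1, h2, dif_pos]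
    linarith
  · have h := hbal {(⟨L + 1, hKK⟩, 0), (⟨L, hLK⟩, 0), (⟨L, hLK⟩, 1)} (⟨L + 1, hKK⟩, 0) (by simp)
    rw [Finset.sum_insert (by simp), Finset.sum_insert (by simp), Finset.sum_singleton] at h
    simp [RetrialQueue.generator, RetrialQueue.Q1, RetrialQueue.Q2, hL, hr, hq] at h
    simp only [hKK, hLK, dif_pos]
    linarith
  · have h := hbal {(⟨L + 1, hKK⟩, n + 1), (⟨L, hLK⟩, n + 1), (⟨L, hLK⟩, n + 2),
      (⟨L + 1, hKK⟩, n)} (⟨L + 1, hKK⟩, n + 1) (by simp)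
    rw [Finset.sum_insert (by simp), Finset.sum_insert (by simp), Finset.sum_insert (by simp),
      Finset.sum_singleton] at h
    simp [RetrialQueue.generator, RetrialQueue.Q0, RetrialQueue.Q1, RetrialQueue.Q2, hL, hr,
      hq] at h
    simp only [hKK, hLK, dif_pos]
    linarith

theorem mainTheorem6 (M : RetrialQueue) (hq : M.q = 1) (hr : M.r = 1)
    (P : ℝ≥0 → M.State → M.State → ℝ)
    (hP : IsTransitionFunction M.generator P) (hErg : IsErgodic P)
    {Ω : Type*} [MeasurableSpace Ω] (ℙ : Measure Ω) [IsProbabilityMeasure ℙ]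
    (C : ℝ≥0 → Ω → Fin (M.K + 1)) (N : ℝ≥0 → Ω → ℕ)
    (hX : IsMarkovChain P ℙ (fun t ω => (C t ω, N t ω)))
    (π : Fin (M.K + 1) → ℕ → ℝ)
    (hπ : ∀ i n,
      Tendsto (fun t => ℙ.real {ω | C t ω = i ∧ N t ω = n}) atTop (𝓝 (π i n)))
    (k : ℕ) (hk : 1 ≤ k) (hkK : k ≤ M.K) :
    ∃ D₁ D₂ : ℝ, 0 < D₁ ∧ 0 < D₂ ∧ ∀ n : ℕ, 1 ≤ n →
      D₁ * (n : ℝ) ^ (M.alpha - k) * M.rho ^ n ≤ π ⟨M.K - k, by omega⟩ n ∧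
      π ⟨M.K - k, by omega⟩ n ≤ D₂ * (n : ℝ) ^ (M.alpha - k) * M.rho ^ n := by
  obtain ⟨w, hw1, hw⟩ := hErg.exists_limit
  obtain ⟨L, hL⟩ := Nat.exists_eq_add_one_of_ne_zero M.K_pos.ne'
  have hπw : ∀ i n, π i n = w (i, n) := fun i n => by
    refine tendsto_nhds_unique (hπ i n) ?_
    simpa [Prod.ext_iff] using hX.tendsto_real hP hw (i, n)
  have S := M.isRetrialSolution hq hr hP hErg hw1 hw hL
  have hν : M.nu (L + 1) ≠ 0 := (S.nu_pos L le_rfl).ne'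
  have hp : M.p ≠ 0 := S.p_pos.ne'
  have hμ : M.mu ≠ 0 := S.mu_pos.ne'
  have hρ : M.rho = M.lam * M.p / M.nu (L + 1) := by rw [RetrialQueue.rho, hL]
  have hα : M.alpha = M.lam / M.mu - M.nu L * (M.lam * M.p / M.mu) / M.nu (L + 1) := by
    rw [RetrialQueue.alpha, hρ, hL, Nat.add_sub_cancel]
    field_simp
  have hlt : L + 1 - k < M.K + 1 := by omega
  have hidx : (⟨M.K - k, by omega⟩ : Fin (M.K + 1)) = ⟨L + 1 - k, hlt⟩ := Fin.ext (by simp [hL])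
  have h := S.exists_bounds k hk (by omega)
  simp only [hlt, dif_pos, ← hα, ← hρ] at h
  simpa only [hidx, hπw] using h
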